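/- Let $n\ge 1$. Let $\mathbf{P\text{Ł}}_n=\langle\{0,\tfrac1n,\dots,\tfrac{n-1}n,1\},\wedge,\vee,\odot,\oplus,0,1\rangle$ with $x\wedge y=\min\{x,y\}$, $x\vee y=\max\{x,y\}$, $x\odot y=\max\{0,x+y-1\}$, $x\oplus y=\min\{1,x+y\}$, and let $\mathsf{PMV}_n$ be the category of all algebras in the variety generated by $\mathbf{P\text{Ł}}_n$, with their homomorphisms. Let $\mathsf{DL}$ be the category of bounded distributive lattices and homomorphisms preserving $\wedge,\vee,0,1$. For $\mathbf L\in\mathsf{DL}$ let $\mathsf D(\mathbf L)=\mathsf{DL}(\mathbf L,\mathbf 2)$ be its Priestley dual, where $\mathbf 2$ is the two-element lattice, with the pointwise order and the topology inherited from the product $\mathbf 2^{L}$ ($\mathbf 2$ discrete); for a homomorphism $h\colon\mathbf L_1\to\mathbf L_2$ let $\mathsf D h\colon \mathsf D(\mathbf L_2)\to\mathsf D(\mathbf L_1)$, $x\mapsto x\circ h$. The distributive skeleton functor $\mathfrak S\colon\mathsf{PMV}_n\to\mathsf{DL}$ sends $\mathbf A$ to the bounded distributive lattice $\{a\in A: a\oplus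 a=a\}$ with the operations $\wedge,\vee,0,1$ inherited from $\mathbf A$, and sends a homomorphism to its restriction. The Priestley power functor $\mathfrak P\colon\mathsf{DL}\to\mathsf{PMV}_n$ sends $\mathbf L$ to the algebra, with component-wise operations, of all continuous order-preserving maps from $\mathsf D(\mathbf L)$ to $\{0,\tfrac1n,\dots,1\}$ (with its usual order and the discrete topology), and sends a homomorphism $h$ to the map $\alpha\mapsto\alpha\circ\mathsf D h$. Then $\mathfrak P$ is right adjoint to $\mathfrak S$, that is, $\mathfrak S\dashv\mathfrak P$. -/

import Mathlib

open CategoryTheory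

universe u

namespace PosMV

/-! ### Algebras of type `⟨∧, ∨, ⊙, ⊕, 0, 1⟩` and generated varieties -/

/-- The operations of an algebra of the type `⟨∧, ∨, ⊙, ⊕, 0, 1⟩`. -/
class Sig (A : Type*) where
  meet : A → A → A
  join : A → A → A
  odot : A → A → A
  oplus : A → A → A
  zero : A
  one : A

open Sig

/-- Homomorphisms of algebras of the type `⟨∧, ∨, ⊙, ⊕, 0, 1⟩`. -/
@[ext]
structure Hom (A B : Type*) [Sig A] [Sig B] where
  toFun : A → B
  map_meet' : ∀ a b, toFun (meet a b) = meet (toFun a) (toFun b)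
  map_join' : ∀ a b, toFun (join a b) = join (toFun a) (toFun b)
  map_odot' : ∀ a b, toFun (odot a b) = odot (toFun a) (toFun b)
  map_oplus' : ∀ a b, toFun (oplus a b) = oplus (toFun a) (toFun b)
  map_zero' : toFun zero = zero
  map_one' : toFun one = one

instance (A B : Type*) [Sig A] [Sig B] : FunLike (Hom A B) A B where
  coe := Hom.toFun
  coe_injective _ _ h := Hom.ext h

/-- The identity homomorphism. -/
def Hom.id (A : Type*) [Sig A] : Hom A A where
  toFun a := a
  map_meet' _ _ := rfl
  map_join' _ _ := rfl
  map_odot' _ _ := rfl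
  map_oplus' _ _ := rfl
  map_zero' := rfl
  map_one' := rfl

/-- Composition of homomorphisms. -/
def Hom.comp {A B C : Type*} [Sig A] [Sig B] [Sig C] (g : Hom B C) (f : Hom A B) : Hom A C where
  toFun a := g.toFun (f.toFun a)
  map_meet' a b := by rw [f.map_meet', g.map_meet']
  map_join' a b := by rw [f.map_join', g.map_join']
  map_odot' a b := by rw [f.map_odot', g.map_odot']
  map_oplus' a b := by rw [f.map_oplus', g.map_oplus']
  map_zero' := by rw [f.map_zero', g.map_zero']
  map_one' := by rw [f.map_one', g.map_one']

/-- Powers, with component-wise operations. -/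
instance (ι M : Type*) [Sig M] : Sig (ι → M) where
  meet x y := fun i => meet (x i) (y i)
  join x y := fun i => join (x i) (y i)
  odot x y := fun i => odot (x i) (y i)
  oplus x y := fun i => oplus (x i) (y i)
  zero := fun _ => zero
  one := fun _ => one

/-- Subalgebras. -/
structure Subalg (B : Type*) [Sig B] where
  carrier : Set B
  meet_mem : ∀ {a b}, a ∈ carrier → b ∈ carrier → meet a b ∈ carrier
  join_mem : ∀ {a b}, a ∈ carrier → b ∈ carrier → join a b ∈ carrier
  odot_mem : ∀ {a b}, a ∈ carrier → b ∈ carrier → odot a b ∈ carrier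
  oplus_mem : ∀ {a b}, a ∈ carrier → b ∈ carrier → oplus a b ∈ carrier
  zero_mem : zero ∈ carrier
  one_mem : one ∈ carrier

instance (B : Type*) [Sig B] (S : Subalg B) : Sig S.carrier where
  meet x y := ⟨meet x.1 y.1, S.meet_mem x.2 y.2⟩
  join x y := ⟨join x.1 y.1, S.join_mem x.2 y.2⟩
  odot x y := ⟨odot x.1 y.1, S.odot_mem x.2 y.2⟩
  oplus x y := ⟨oplus x.1 y.1, S.oplus_mem x.2 y.2⟩
  zero := ⟨zero, S.zero_mem⟩
  one := ⟨one, S.one_mem⟩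

/-- `A` belongs to the variety `HSP(M)` generated by `M`: it is a homomorphic image of a
subalgebra of a power of `M`. (Index sets in the universe of `A` suffice, since one may always
take the set of all maps `A → M` as index set.) -/
def InVariety (M : Type) [Sig M] (A : Type u) [Sig A] : Prop :=
  ∃ (ι : Type u) (S : Subalg (ι → M)) (f : Hom S.carrier A), Function.Surjective f

/-! ### The finite positive MV-chains -/

/-- The set `{0, 1/n, …, (n-1)/n, 1}` of real numbers, for `n ≥ 1`. -/
def chain (n : ℕ) : Set ℝ := {x | ∃ k : ℕ, k ≤ n ∧ x = (k : ℝ) / n}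

theorem chain_nonneg {n : ℕ} {x : ℝ} (hx : x ∈ chain n) : 0 ≤ x := by
  obtain ⟨k, _, rfl⟩ := hx
  positivity

theorem chain_le_one {n : ℕ} {x : ℝ} (hx : x ∈ chain n) : x ≤ 1 := by
  obtain ⟨k, hk, rfl⟩ := hx
  exact div_le_one_of_le₀ (by exact_mod_cast hk) (by positivity)

instance (n : ℕ) : Finite (chain n) := by
  have : chain n ⊆ (fun k : ℕ => (k : ℝ) / n) '' Set.Iic n := by
    rintro x ⟨k, hk, rfl⟩
    exact ⟨k, hk, rfl⟩
  exact ((Set.finite_Iic n).image _).subset this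

/-- The topology of the chain, inherited from the real line, is the discrete one. -/
instance (n : ℕ) : DiscreteTopology (chain n) := inferInstance

section Chain

variable (n : ℕ) [NeZero n]

/-- The `(n+1)`-element positive MV-chain `PŁ_n`: the negation-free reduct of the subalgebra
`{0, 1/n, …, 1}` of the standard MV-algebra on `[0,1]`. -/
noncomputable instance : Sig (chain n) where
  meet x y := ⟨min x.1 y.1, by rcases min_choice x.1 y.1 with h | h <;> rw [h]; exacts [x.2, y.2]⟩
  join x y := ⟨max x.1 y.1, by rcases max_choice x.1 y.1 with h | h <;> rw [h]; exacts [x.2, y.2]⟩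
  odot x y := ⟨max 0 (x.1 + y.1 - 1), by
    have hn : (n : ℝ) ≠ 0 := by exact_mod_cast NeZero.ne n
    obtain ⟨⟨x, k, hk, rfl⟩, ⟨y, l, hl, rfl⟩⟩ := x, y
    refine ⟨k + l - n, by omega, ?_⟩
    have e : (k : ℝ) / n + l / n - 1 = ((k : ℝ) + l - n) / n := by field_simp
    rw [e]
    rcases le_total n (k + l) with h | h
    · have h' : (n : ℝ) ≤ k + l := by exact_mod_cast h
      rw [max_eq_right (div_nonneg (by linarith) (by positivity)), Nat.cast_sub h]
      push_cast
      rfl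
    · have h' : (k : ℝ) + l ≤ n := by exact_mod_cast h
      rw [max_eq_left (div_nonpos_of_nonpos_of_nonneg (by linarith) (by positivity)),
        Nat.sub_eq_zero_of_le h]
      simp⟩
  oplus x y := ⟨min 1 (x.1 + y.1), by
    have hn : (n : ℝ) ≠ 0 := by exact_mod_cast NeZero.ne n
    have hp : (0 : ℝ) < n := by exact_mod_cast Nat.pos_of_ne_zero (NeZero.ne n)
    obtain ⟨⟨x, k, hk, rfl⟩, ⟨y, l, hl, rfl⟩⟩ := x, y
    refine ⟨min n (k + l), by omega, ?_⟩
    have e : (k : ℝ) / n + l / n = ((k : ℝ) + l) / n := by field_simp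
    simp only [e]
    rcases le_total n (k + l) with h | h
    · have h' : (n : ℝ) ≤ k + l := by exact_mod_cast h
      rw [min_eq_left h, min_eq_left ((one_le_div hp).2 h'), div_self hn]
    · have h' : (k : ℝ) + l ≤ n := by exact_mod_cast h
      rw [min_eq_right h, min_eq_right ((div_le_one hp).2 h')]
      push_cast
      rfl⟩
  zero := ⟨0, 0, by omega, by simp⟩
  one := ⟨1, n, le_rfl, by
    have hn : (n : ℝ) ≠ 0 := by exact_mod_cast NeZero.ne n
    rw [div_self hn]⟩

theorem odot_mono {x x' y y' : chain n} (hx : x ≤ x') (hy : y ≤ y') : odot x y ≤ odot x' y' := by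
  have hx' : x.1 ≤ x'.1 := hx
  have hy' : y.1 ≤ y'.1 := hy
  change max 0 (x.1 + y.1 - 1) ≤ max 0 (x'.1 + y'.1 - 1)
  exact max_le_max le_rfl (by linarith)

theorem oplus_mono {x x' y y' : chain n} (hx : x ≤ x') (hy : y ≤ y') :
    oplus x y ≤ oplus x' y' := by
  have hx' : x.1 ≤ x'.1 := hx
  have hy' : y.1 ≤ y'.1 := hy
  change min 1 (x.1 + y.1) ≤ min 1 (x'.1 + y'.1)
  exact min_le_min le_rfl (by linarith)

end Chain

/-! ### The category of positive `MV_n`-algebras -/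

/-- Positive `MV_n`-algebras: the members of the variety generated by `PŁ_n`. -/
structure PMV (n : ℕ) [NeZero n] : Type (u + 1) where
  carrier : Type u
  [sig : Sig carrier]
  mem_variety : InVariety (chain n) carrier

attribute [instance] PMV.sig

instance (n : ℕ) [NeZero n] : CoeSort (PMV.{u} n) (Type u) := ⟨PMV.carrier⟩

/-- The category of positive `MV_n`-algebras and all homomorphisms between them. -/
instance (n : ℕ) [NeZero n] : Category.{u} (PMV.{u} n) where
  Hom A B := Hom A B
  id A := Hom.id A
  comp f g := Hom.comp g f

/-! ### The distributive skeleton -/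

/-- The carrier `{a | a ⊕ a = a}` of the distributive skeleton. -/
def Skel (A : Type*) [Sig A] : Type _ := {a : A // oplus a a = a}

section Skeleton

variable {n : ℕ} [NeZero n] (A : PMV.{u} n)

/-- The identity `(a ∧ b) ⊕ (a ∧ b) = (a ⊕ a) ∧ (b ⊕ b)`. -/
theorem double_meet (a b : A) : oplus (meet a b) (meet a b) = meet (oplus a a) (oplus b b) := by
  obtain ⟨ι, S, f, hf⟩ := A.mem_variety
  obtain ⟨x, rfl⟩ := hf a
  obtain ⟨y, rfl⟩ := hf b
  change oplus (meet (f.toFun x) (f.toFun y)) (meet (f.toFun x) (f.toFun y)) =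
    meet (oplus (f.toFun x) (f.toFun x)) (oplus (f.toFun y) (f.toFun y))
  simp only [← f.map_meet', ← f.map_oplus']
  refine congrArg f.toFun (Subtype.ext (funext fun i => Subtype.ext ?_))
  change min 1 (min (x.1 i).1 (y.1 i).1 + min (x.1 i).1 (y.1 i).1) =
    min (min 1 ((x.1 i).1 + (x.1 i).1)) (min 1 ((y.1 i).1 + (y.1 i).1))
  grind

/-- The identity `(a ∨ b) ⊕ (a ∨ b) = (a ⊕ a) ∨ (b ⊕ b)`. -/
theorem double_join (a b : A) : oplus (join a b) (join a b) = join (oplus a a) (oplus b b) := by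
  obtain ⟨ι, S, f, hf⟩ := A.mem_variety
  obtain ⟨x, rfl⟩ := hf a
  obtain ⟨y, rfl⟩ := hf b
  change oplus (join (f.toFun x) (f.toFun y)) (join (f.toFun x) (f.toFun y)) =
    join (oplus (f.toFun x) (f.toFun x)) (oplus (f.toFun y) (f.toFun y))
  simp only [← f.map_join', ← f.map_oplus']
  refine congrArg f.toFun (Subtype.ext (funext fun i => Subtype.ext ?_))
  change min 1 (max (x.1 i).1 (y.1 i).1 + max (x.1 i).1 (y.1 i).1) =
    max (min 1 ((x.1 i).1 + (x.1 i).1)) (min 1 ((y.1 i).1 + (y.1 i).1))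
  grind

theorem double_zero : oplus (zero : A) zero = zero := by
  obtain ⟨ι, S, f, _⟩ := A.mem_variety
  rw [← f.map_zero', ← f.map_oplus']
  refine congrArg f.toFun (Subtype.ext (funext fun i => Subtype.ext ?_))
  change min (1 : ℝ) (0 + 0) = 0
  norm_num

theorem double_one : oplus (one : A) one = one := by
  obtain ⟨ι, S, f, _⟩ := A.mem_variety
  rw [← f.map_one', ← f.map_oplus']
  refine congrArg f.toFun (Subtype.ext (funext fun i => Subtype.ext ?_))
  change min (1 : ℝ) (1 + 1) = 1
  norm_num

/-- The bounded distributive lattice identities hold in every positive `MV_n`-algebra. -/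
theorem lattice_identities (a b c : A) :
    join a b = join b a ∧ join (join a b) c = join a (join b c) ∧
    meet a b = meet b a ∧ meet (meet a b) c = meet a (meet b c) ∧
    join a (meet a b) = a ∧ meet a (join a b) = a ∧
    join (meet (join a b) (join a c)) (join a (meet b c)) = join a (meet b c) ∧
    join zero a = a ∧ join a one = one := by
  obtain ⟨ι, S, f, hf⟩ := A.mem_variety
  obtain ⟨x, rfl⟩ := hf a
  obtain ⟨y, rfl⟩ := hf b
  obtain ⟨z, rfl⟩ := hf c
  simp only [show ∀ w, f w = f.toFun w from fun _ => rfl, ← f.map_meet', ← f.map_join',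
    ← f.map_zero', ← f.map_one']
  refine ⟨?_, ?_, ?_, ?_, ?_, ?_, ?_, ?_, ?_⟩ <;>
    refine congrArg f.toFun (Subtype.ext (funext fun i => Subtype.ext ?_))
  · exact max_comm _ _
  · exact max_assoc _ _ _
  · exact min_comm _ _
  · exact min_assoc _ _ _
  · exact sup_inf_self
  · exact inf_sup_self
  · exact sup_eq_right.2 le_sup_inf
  · exact max_eq_right (chain_nonneg (x.1 i).2)
  · exact max_eq_right (chain_le_one (x.1 i).2)

instance : Max (Skel A) := ⟨fun a b => ⟨join a.1 b.1, by rw [double_join, a.2, b.2]⟩⟩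

instance : Min (Skel A) := ⟨fun a b => ⟨meet a.1 b.1, by rw [double_meet, a.2, b.2]⟩⟩

/-- The distributive skeleton, with the lattice operations inherited from `A`. -/
instance : DistribLattice (Skel A) where
  __ := Lattice.mk'
    (fun a b : Skel A => Subtype.ext (lattice_identities A a.1 b.1 a.1).1)
    (fun a b c => Subtype.ext (lattice_identities A a.1 b.1 c.1).2.1)
    (fun a b => Subtype.ext (lattice_identities A a.1 b.1 a.1).2.2.1)
    (fun a b c => Subtype.ext (lattice_identities A a.1 b.1 c.1).2.2.2.1)
    (fun a b => Subtype.ext (lattice_identities A a.1 b.1 a.1).2.2.2.2.1)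
    (fun a b => Subtype.ext (lattice_identities A a.1 b.1 a.1).2.2.2.2.2.1)
  le_sup_inf a b c := Subtype.ext (lattice_identities A a.1 b.1 c.1).2.2.2.2.2.2.1

/-- The bounds of the distributive skeleton are the constants `0` and `1` of `A`. -/
instance : BoundedOrder (Skel A) where
  bot := ⟨zero, double_zero A⟩
  bot_le a := Subtype.ext (lattice_identities A a.1 a.1 a.1).2.2.2.2.2.2.2.1
  top := ⟨one, double_one A⟩
  le_top a := Subtype.ext (lattice_identities A a.1 a.1 a.1).2.2.2.2.2.2.2.2

/-- The restriction of a homomorphism to the distributive skeletons. -/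
def skelMap {A B : PMV.{u} n} (h : A ⟶ B) : BoundedLatticeHom (Skel A) (Skel B) where
  toFun a := ⟨Hom.toFun h a.1, by rw [← Hom.map_oplus' h, a.2]⟩
  map_sup' a b := Subtype.ext (Hom.map_join' h a.1 b.1)
  map_inf' a b := Subtype.ext (Hom.map_meet' h a.1 b.1)
  map_top' := Subtype.ext (Hom.map_one' h)
  map_bot' := Subtype.ext (Hom.map_zero' h)

end Skeleton

/-- The distributive skeleton functor `𝔖 : PMV_n ⥤ DL`. -/
def skeletonFunctor (n : ℕ) [NeZero n] : PMV.{u} n ⥤ BddDistLat.{u} where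
  obj A := BddDistLat.of (Skel A)
  map h := BddDistLat.ofHom (skelMap h)
  map_id _ := rfl
  map_comp _ _ := rfl

/-! ### Priestley duals and Priestley powers -/

/-- The underlying set of the Priestley dual `D(L)`: the bounded lattice homomorphisms from `L`
to the two-element lattice. -/
def Dual (L : Type*) [Lattice L] [BoundedOrder L] : Type _ := BoundedLatticeHom L Bool

section Dual

variable (L : Type*) [Lattice L] [BoundedOrder L]

instance : FunLike (Dual L) L Bool := inferInstanceAs (FunLike (BoundedLatticeHom L Bool) L Bool)

/-- The point-wise order on `D(L)`. -/
noncomputable instance : PartialOrder (Dual L) :=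
  PartialOrder.lift (fun (x : Dual L) (a : L) => x a) DFunLike.coe_injective

/-- The topology of point-wise convergence on `D(L)`, that is, the one inherited from the power
of the two-element discrete space. -/
instance : TopologicalSpace (Dual L) :=
  TopologicalSpace.induced (fun (x : Dual L) (a : L) => x a) Pi.topologicalSpace

variable {L} {L' : Type*} [Lattice L'] [BoundedOrder L']

/-- The continuous order-preserving map `D(h) : D(L') → D(L)`, `x ↦ x ∘ h`. -/
noncomputable def dualMap (h : BoundedLatticeHom L L') : Dual L' →Co Dual L where
  toFun x := BoundedLatticeHom.comp x h
  monotone' _ _ hxy a := hxy (h a)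
  continuous_toFun := continuous_induced_rng.2
    (continuous_pi fun a => (continuous_apply (h a)).comp continuous_induced_dom)

end Dual

/-- The Priestley power `M[L]` of an ordered algebra `M`, here a discrete ordered space: the
continuous order-preserving maps from `D(L)` to `M`. -/
abbrev PriestleyPower (M : Type*) [Preorder M] [TopologicalSpace M]
    (L : Type*) [Lattice L] [BoundedOrder L] : Type _ :=
  Dual L →Co M

section Power

variable (n : ℕ) [NeZero n] (L : Type u) [Lattice L] [BoundedOrder L]

/-- The component-wise operations on the Priestley power `PŁ_n[L]`. -/
noncomputable instance : Sig (PriestleyPower (chain n) L) where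
  meet α β :=
    { toFun := fun x => meet (α x) (β x)
      monotone' := fun _ _ h => inf_le_inf (α.monotone' h) (β.monotone' h)
      continuous_toFun := (continuous_of_discreteTopology
        (f := fun p : chain n × chain n => meet p.1 p.2)).comp
          (α.continuous_toFun.prodMk β.continuous_toFun) }
  join α β :=
    { toFun := fun x => join (α x) (β x)
      monotone' := fun _ _ h => sup_le_sup (α.monotone' h) (β.monotone' h)
      continuous_toFun := (continuous_of_discreteTopology
        (f := fun p : chain n × chain n => join p.1 p.2)).comp
          (α.continuous_toFun.prodMk β.continuous_toFun) }
  odot α β :=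
    { toFun := fun x => odot (α x) (β x)
      monotone' := fun _ _ h => odot_mono n (α.monotone' h) (β.monotone' h)
      continuous_toFun := (continuous_of_discreteTopology
        (f := fun p : chain n × chain n => odot p.1 p.2)).comp
          (α.continuous_toFun.prodMk β.continuous_toFun) }
  oplus α β :=
    { toFun := fun x => oplus (α x) (β x)
      monotone' := fun _ _ h => oplus_mono n (α.monotone' h) (β.monotone' h)
      continuous_toFun := (continuous_of_discreteTopology
        (f := fun p : chain n × chain n => oplus p.1 p.2)).comp
          (α.continuous_toFun.prodMk β.continuous_toFun) }
  zero := ⟨⟨fun _ => zero, monotone_const⟩, continuous_const⟩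
  one := ⟨⟨fun _ => one, monotone_const⟩, continuous_const⟩

/-- The Priestley power as a subalgebra of the power of `PŁ_n` with exponent `D(L)`. -/
noncomputable def powerSubalg : Subalg (Dual L → chain n) where
  carrier := Set.range fun (α : PriestleyPower (chain n) L) (x : Dual L) => α x
  meet_mem := by rintro _ _ ⟨α, rfl⟩ ⟨β, rfl⟩; exact ⟨meet α β, rfl⟩
  join_mem := by rintro _ _ ⟨α, rfl⟩ ⟨β, rfl⟩; exact ⟨join α β, rfl⟩
  odot_mem := by rintro _ _ ⟨α, rfl⟩ ⟨β, rfl⟩; exact ⟨odot α β, rfl⟩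
  oplus_mem := by rintro _ _ ⟨α, rfl⟩ ⟨β, rfl⟩; exact ⟨oplus α β, rfl⟩
  zero_mem := ⟨zero, rfl⟩
  one_mem := ⟨one, rfl⟩

theorem power_mem_variety : InVariety (chain n) (PriestleyPower (chain n) L) := by
  have ex : ∀ y : (powerSubalg n L).carrier, ∃ α : PriestleyPower (chain n) L,
      (fun x => α x) = y.1 := fun y => y.2
  choose g hg using ex
  have key : ∀ (y : (powerSubalg n L).carrier) (α : PriestleyPower (chain n) L),
      y.1 = (fun x => α x) → g y = α := fun y α h =>
    ContinuousOrderHom.ext fun x => congrFun ((hg y).trans h) x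
  refine ⟨Dual L, powerSubalg n L, ⟨g, fun y z => ?_, fun y z => ?_, fun y z => ?_,
    fun y z => ?_, key _ _ rfl, key _ _ rfl⟩, fun α => ⟨⟨_, α, rfl⟩, key _ α rfl⟩⟩
  · exact key _ _ (congrArg₂ meet (hg y).symm (hg z).symm)
  · exact key _ _ (congrArg₂ join (hg y).symm (hg z).symm)
  · exact key _ _ (congrArg₂ odot (hg y).symm (hg z).symm)
  · exact key _ _ (congrArg₂ oplus (hg y).symm (hg z).symm)

variable {L} {L' : Type u} [Lattice L'] [BoundedOrder L']

/-- The homomorphism `M[L] → M[L']`, `α ↦ α ∘ D(h)`, for `M = PŁ_n`. -/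
noncomputable def powerMap (h : BoundedLatticeHom L L') :
    Hom (PriestleyPower (chain n) L) (PriestleyPower (chain n) L') where
  toFun α := α.comp (dualMap h)
  map_meet' _ _ := rfl
  map_join' _ _ := rfl
  map_odot' _ _ := rfl
  map_oplus' _ _ := rfl
  map_zero' := rfl
  map_one' := rfl

end Power

/-- The Priestley power functor `𝔓 : DL ⥤ PMV_n`. -/
noncomputable def priestleyPowerFunctor (n : ℕ) [NeZero n] : BddDistLat.{u} ⥤ PMV.{u} n where
  obj L := { carrier := PriestleyPower (chain n) L, mem_variety := power_mem_variety n L }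
  map h := powerMap n h.hom
  map_id _ := rfl
  map_comp _ _ := rfl

end PosMV

namespace PosMV

open Sig

/-! The argument rests on unary terms `τ_k` (`threshold n k`) which on the chain are the
characteristic functions of `{x | k / n ≤ x}`. Their values are idempotent for `⊕`, so in every
algebra `A` of the variety they map `A` into its skeleton, and every homomorphism commutes with
them. An element `a` thus yields a decreasing family `τ_0 a = 1 ≥ τ_1 a ≥ ⋯ ≥ τ_n a` in the
skeleton.

The unit sends `a` to the function whose value at a point `x` of the dual of the skeleton is the
largest `k / n` with `x (τ_k a) = 1`. Preservation of the operations follows from inequalities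
between threshold terms, which are identities of the chain (`InVariety.evalHom_eq`), together with
the fact that `x` preserves finite meets and joins (`le_num_level`, `level_odot`, `level_oplus`).

The counit comes from Priestley duality: for `α` in the skeleton of the Priestley power, the set
where `α = 1` is a clopen up-set of the dual of `L`, hence is represented by an element of `L`
(`exists_mem_iff_of_isClopen`), unique because the points of the dual separate `L`. The triangle
identities amount to `τ_n a = a` for `a` in the skeleton, and to `τ_k α` being `1` at `x` exactly
when `k / n ≤ α x`. -/

/-! ### Terms and the transfer of identities -/

/-- Terms in the operations `⟨∧, ∨, ⊙, ⊕, 0, 1⟩` over a set of variables. -/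
inductive Term (V : Type) : Type
  | var : V → Term V
  | meet : Term V → Term V → Term V
  | join : Term V → Term V → Term V
  | odot : Term V → Term V → Term V
  | oplus : Term V → Term V → Term V
  | zero : Term V
  | one : Term V

/-- With terms forming an algebra, derived operations such as `threshold` can be applied to
variables directly, and evaluation passes through them because it is a homomorphism. -/
instance (V : Type) : Sig (Term V) where
  meet := Term.meet
  join := Term.join
  odot := Term.odot
  oplus := Term.oplus
  zero := Term.zero
  one := Term.one

/-- The value of a term under an assignment of its variables. -/
def Term.value {V : Type} {A : Type*} [Sig A] (v : V → A) : Term V → A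
  | .var i => v i
  | .meet s t => Sig.meet (s.value v) (t.value v)
  | .join s t => Sig.join (s.value v) (t.value v)
  | .odot s t => Sig.odot (s.value v) (t.value v)
  | .oplus s t => Sig.oplus (s.value v) (t.value v)
  | .zero => Sig.zero
  | .one => Sig.one

/-- Evaluation of terms as a homomorphism from the term algebra. -/
def Term.evalHom {V : Type} {A : Type*} [Sig A] (v : V → A) : Hom (Term V) A where
  toFun := Term.value v
  map_meet' _ _ := rfl
  map_join' _ _ := rfl
  map_odot' _ _ := rfl
  map_oplus' _ _ := rfl
  map_zero' := rfl
  map_one' := rfl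

theorem Hom.map_value {V : Type} {A B : Type*} [Sig A] [Sig B] (f : Hom A B) (v : V → A)
    (t : Term V) : f.toFun (t.value v) = t.value (fun i => f.toFun (v i)) := by
  induction t with
  | var i => rfl
  | meet s t hs ht => simp only [Term.value, f.map_meet', hs, ht]
  | join s t hs ht => simp only [Term.value, f.map_join', hs, ht]
  | odot s t hs ht => simp only [Term.value, f.map_odot', hs, ht]
  | oplus s t hs ht => simp only [Term.value, f.map_oplus', hs, ht]
  | zero => exact f.map_zero'
  | one => exact f.map_one'

/-- The homomorphism given by a coordinate of a subalgebra of a power. -/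
def Subalg.coord {ι M : Type*} [Sig M] (S : Subalg (ι → M)) (i : ι) : Hom S.carrier M where
  toFun x := x.1 i
  map_meet' _ _ := rfl
  map_join' _ _ := rfl
  map_odot' _ _ := rfl
  map_oplus' _ _ := rfl
  map_zero' := rfl
  map_one' := rfl

/-- Identities of `M` hold in the variety generated by `M`. -/
theorem InVariety.evalHom_eq {M : Type} [Sig M] {A : Type u} [Sig A] (hA : InVariety M A)
    {V : Type} {s t : Term V}
    (h : ∀ v : V → M, (Term.evalHom v).toFun s = (Term.evalHom v).toFun t) (v : V → A) :
    (Term.evalHom v).toFun s = (Term.evalHom v).toFun t := by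
  obtain ⟨ι, S, f, hf⟩ := hA
  choose g hg using hf
  have hv : v = fun i => f.toFun (g (v i)) := funext fun i => (hg (v i)).symm
  change s.value v = t.value v
  rw [hv, ← f.map_value, ← f.map_value]
  -- The assignment has been lifted to the subalgebra of a power, where equality is checked at each
  -- coordinate, that is, in `M`.
  refine congrArg f.toFun (Subtype.ext (funext fun i => ?_))
  have e := h fun j => (S.coord i).toFun (g (v j))
  change s.value _ = t.value _ at e
  rw [← (S.coord i).map_value, ← (S.coord i).map_value] at e
  exact e

/-! ### Numerators of elements of the chain -/

section Chain

variable {n : ℕ}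

/-- The numerator `k` of the element `k / n` of the chain. -/
noncomputable def num (x : chain n) : ℕ := x.2.choose

theorem num_le (x : chain n) : num x ≤ n := x.2.choose_spec.1

theorem coe_eq_num_div (x : chain n) : x.1 = (num x : ℝ) / n := x.2.choose_spec.2

/-- The element `k / n` of the chain. -/
noncomputable def ofNum (k : ℕ) (hk : k ≤ n) : chain n := ⟨(k : ℝ) / n, k, hk, rfl⟩

variable [NeZero n]

theorem num_eq_of_coe {x : chain n} {k : ℕ} (h : x.1 * n = k) : num x = k := by
  have hn : (n : ℝ) ≠ 0 := by exact_mod_cast NeZero.ne n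
  rw [coe_eq_num_div, div_mul_cancel₀ _ hn] at h
  exact_mod_cast h

theorem coe_mul_eq_num (x : chain n) : x.1 * n = num x := by
  have hn : (n : ℝ) ≠ 0 := by exact_mod_cast NeZero.ne n
  rw [coe_eq_num_div, div_mul_cancel₀ _ hn]

theorem num_ofNum (k : ℕ) (hk : k ≤ n) : num (ofNum k hk) = k := by
  have hn : (n : ℝ) ≠ 0 := by exact_mod_cast NeZero.ne n
  exact num_eq_of_coe (div_mul_cancel₀ _ hn)

theorem num_le_num {x y : chain n} : num x ≤ num y ↔ x ≤ y := by
  have hp : (0 : ℝ) < n := by exact_mod_cast Nat.pos_of_ne_zero (NeZero.ne n)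
  rw [← Nat.cast_le (α := ℝ), ← coe_mul_eq_num, ← coe_mul_eq_num]
  exact mul_le_mul_iff_left₀ hp

theorem num_injective : Function.Injective (num : chain n → ℕ) := fun _ _ h =>
  le_antisymm (num_le_num.1 h.le) (num_le_num.1 h.ge)

theorem num_meet (x y : chain n) : num (meet x y) = min (num x) (num y) := by
  apply num_eq_of_coe
  change min x.1 y.1 * n = _
  rw [min_mul_of_nonneg _ _ (by positivity), coe_mul_eq_num, coe_mul_eq_num, Nat.cast_min]

theorem num_join (x y : chain n) : num (join x y) = max (num x) (num y) := by
  apply num_eq_of_coe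
  change max x.1 y.1 * n = _
  rw [max_mul_of_nonneg _ _ (by positivity), coe_mul_eq_num, coe_mul_eq_num, Nat.cast_max]

theorem num_oplus (x y : chain n) : num (oplus x y) = min n (num x + num y) := by
  apply num_eq_of_coe
  change min 1 (x.1 + y.1) * n = _
  rw [min_mul_of_nonneg _ _ (by positivity), add_mul, coe_mul_eq_num, coe_mul_eq_num, one_mul]
  push_cast
  rfl

/-- Truncated subtraction of natural numbers absorbs the `max 0`. On numerators all operations
become linear arithmetic with `min`, `max` and truncation, which `omega` decides. -/
theorem num_odot (x y : chain n) : num (odot x y) = num x + num y - n := by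
  apply num_eq_of_coe
  change max 0 (x.1 + y.1 - 1) * n = _
  rw [max_mul_of_nonneg _ _ (by positivity), sub_mul, add_mul, coe_mul_eq_num, coe_mul_eq_num,
    one_mul, zero_mul]
  rcases le_total n (num x + num y) with h | h
  · have h' : (n : ℝ) ≤ num x + num y := by exact_mod_cast h
    rw [Nat.cast_sub h, max_eq_right (by linarith), Nat.cast_add]
  · have h' : (num x + num y : ℝ) ≤ n := by exact_mod_cast h
    rw [Nat.sub_eq_zero_of_le h, max_eq_left (by linarith), Nat.cast_zero]

theorem num_zero : num (zero : chain n) = 0 :=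
  num_eq_of_coe (by change (0 : ℝ) * n = _; simp)

theorem num_one : num (one : chain n) = n :=
  num_eq_of_coe (by change (1 : ℝ) * n = _; simp)

end Chain

/-! ### Threshold terms -/

section Threshold

variable {A B : Type*} [Sig A] [Sig B]

/-- The composition of doublings `x ⊕ x` and squarings `x ⊙ x` which on `[0,1]` is the truncation
of `2 ^ m * x - c` to `[0,1]`. -/
def dyadic : ℕ → ℕ → A → A
  | 0, _, a => a
  | m + 1, c, a =>
    if c % 2 = 0 then oplus (dyadic m (c / 2) a) (dyadic m (c / 2) a)
    else odot (dyadic m (c / 2) a) (dyadic m (c / 2) a)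

/-- The unary term which on the chain `{0, 1/n, …, 1}` is the characteristic function of
`{x | k / n ≤ x}`. -/
def threshold (n k : ℕ) (a : A) : A :=
  if k = 0 then one else if n < k then zero else
    dyadic (n + 1) ((2 ^ (n + 1) * (k - 1) + n - 1) / n) a

theorem Hom.map_dyadic (f : Hom A B) (m c : ℕ) (a : A) :
    f.toFun (dyadic m c a) = dyadic m c (f.toFun a) := by
  induction m generalizing c with
  | zero => rfl
  | succ m ih =>
    unfold dyadic
    split
    · rw [f.map_oplus', ih]
    · rw [f.map_odot', ih]

theorem Hom.map_threshold (f : Hom A B) (n k : ℕ) (a : A) :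
    f.toFun (threshold n k a) = threshold n k (f.toFun a) := by
  unfold threshold
  split
  · exact f.map_one'
  split
  · exact f.map_zero'
  · exact f.map_dyadic _ _ _

variable {n : ℕ} [NeZero n]

/-- The binary digits of `c` select the operations, the least significant digit being applied last:
doubling turns the truncation of `y` into that of `2y`, and squaring into that of `2y - 1`. The
bound on `c` says that `m` digits suffice. -/
theorem num_dyadic (m c : ℕ) (hc : c < 2 ^ m) (x : chain n) :
    num (dyadic m c x) = min n (2 ^ m * num x - c * n) := by
  induction m generalizing c with
  | zero =>
    obtain rfl : c = 0 := by simpa using hc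
    simpa [dyadic] using num_le x
  | succ m ih =>
    have ih := ih (c / 2) (by rw [pow_succ] at hc; omega)
    have e : 2 ^ (m + 1) * num x = 2 * (2 ^ m * num x) := by ring
    unfold dyadic
    split
    · have ec : c * n = 2 * (c / 2 * n) := by
        rw [← mul_assoc]
        congr 1
        omega
      rw [num_oplus, ih, e, ec]
      generalize 2 ^ m * num x = z
      generalize c / 2 * n = t
      omega
    · have ec : c * n = 2 * (c / 2 * n) + n := by
        rw [← mul_assoc, ← Nat.succ_mul]
        congr 1
        omega
      rw [num_odot, ih, e, ec]
      generalize 2 ^ m * num x = z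
      generalize c / 2 * n = t
      omega

theorem num_threshold (k : ℕ) (x : chain n) :
    num (threshold n k x) = if k ≤ num x then n else 0 := by
  have hx := num_le x
  have hn : 0 < n := Nat.pos_of_ne_zero (NeZero.ne n)
  unfold threshold
  split
  · rw [num_one, if_pos (by omega)]
  split
  · rw [num_zero, if_neg (by omega)]
  obtain ⟨j, rfl⟩ : ∃ j, k = j + 1 := ⟨k - 1, by omega⟩
  rw [Nat.add_sub_cancel]
  set N := 2 ^ (n + 1) with hN
  -- The exponent `n + 1` makes the slope `N` steep enough for the truncation to climb from `0` to
  -- `1` between two neighbours of the chain, even after `c` is rounded up.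
  have hN2 : 2 * n ≤ N := by
    have := (Nat.lt_two_pow_self (n := n)).le
    rw [hN, pow_succ]
    omega
  -- This is `N * j / n` rounded up: by `h2` numerators at most `j` are sent to `0`, and by `h1` and
  -- `hN2` numerators at least `j + 1` are sent to `n`.
  set c := (N * j + n - 1) / n with hc
  have h1 : c * n ≤ N * j + n - 1 := Nat.div_mul_le_self _ _
  have h2 : N * j ≤ c * n := by
    have := Nat.lt_div_mul_add (a := N * j + n - 1) hn
    rw [← hc] at this
    omega
  have h3 : N * (j + 1) ≤ N * n := Nat.mul_le_mul_left _ (by omega)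
  rw [Nat.mul_succ] at h3
  have h4 : c < N := by
    refine lt_of_mul_lt_mul_right (a := n) ?_ (Nat.zero_le _)
    omega
  rw [num_dyadic _ _ h4]
  split_ifs with h
  · have h5 : N * (j + 1) ≤ N * num x := Nat.mul_le_mul_left _ h
    rw [Nat.mul_succ] at h5
    change min n (N * num x - c * n) = n
    omega
  · have h5 : N * num x ≤ N * j := Nat.mul_le_mul_left _ (by omega)
    change min n (N * num x - c * n) = 0
    omega

end Threshold

/-! ### Inequalities between threshold terms in the skeleton -/

section Identities

variable {n : ℕ} [NeZero n] (A : PMV.{u} n)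

/-- A binary identity between terms built with thresholds, transferred from the chain. -/
theorem PMV.evalHom_eq {s t : Term Bool}
    (h : ∀ v : Bool → chain n, num ((Term.evalHom v).toFun s) = num ((Term.evalHom v).toFun t))
    (a b : A) :
    (Term.evalHom fun i => cond i a b).toFun s = (Term.evalHom fun i => cond i a b).toFun t :=
  A.mem_variety.evalHom_eq (fun v => num_injective (h v)) _

theorem Term.evalHom_var {V : Type} {A : Type*} [Sig A] (v : V → A) (i : V) :
    (Term.evalHom v).toFun (Term.var i) = v i := rfl

theorem double_threshold (k : ℕ) (a : A) :
    oplus (threshold n k a) (threshold n k a) = threshold n k a := by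
  simpa only [Hom.map_oplus', Hom.map_threshold, Term.evalHom_var, cond_true] using
    A.evalHom_eq (s := oplus (threshold n k (.var true)) (threshold n k (.var true)))
      (t := threshold n k (.var true)) (fun v => by
        simp only [Hom.map_oplus', Hom.map_threshold, Term.evalHom_var, num_oplus, num_threshold]
        split_ifs <;> omega) a a

/-- The threshold terms as maps into the distributive skeleton. -/
def skelThreshold (k : ℕ) (a : A) : Skel A := ⟨threshold n k a, double_threshold A k a⟩

theorem skelThreshold_meet (k : ℕ) (a b : A) :
    skelThreshold A k (meet a b) = skelThreshold A k a ⊓ skelThreshold A k b := by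
  apply Subtype.ext
  change threshold n k (meet a b) = meet (threshold n k a) (threshold n k b)
  simpa only [Hom.map_meet', Hom.map_threshold, Term.evalHom_var, cond_true, cond_false] using
    A.evalHom_eq (s := threshold n k (meet (.var true) (.var false)))
      (t := meet (threshold n k (.var true)) (threshold n k (.var false))) (fun v => by
        simp only [Hom.map_meet', Hom.map_threshold, Term.evalHom_var, num_meet, num_threshold]
        split_ifs <;> omega) a b

theorem skelThreshold_join (k : ℕ) (a b : A) :
    skelThreshold A k (join a b) = skelThreshold A k a ⊔ skelThreshold A k b := by
  apply Subtype.ext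
  change threshold n k (join a b) = join (threshold n k a) (threshold n k b)
  simpa only [Hom.map_join', Hom.map_threshold, Term.evalHom_var, cond_true, cond_false] using
    A.evalHom_eq (s := threshold n k (join (.var true) (.var false)))
      (t := join (threshold n k (.var true)) (threshold n k (.var false))) (fun v => by
        simp only [Hom.map_join', Hom.map_threshold, Term.evalHom_var, num_join, num_threshold]
        split_ifs <;> omega) a b

/-- This and the next three results bound the thresholds of `a ⊕ b` and `a ⊙ b` from both sides;
with `i` and `j` the levels of `a` and `b` at a point, they pinch the level of the result. The bound
`hij` reflects truncation: above `n` the threshold is `0`. -/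
theorem inf_le_skelThreshold_oplus (i j : ℕ) (hij : i + j ≤ n) (a b : A) :
    skelThreshold A i a ⊓ skelThreshold A j b ≤ skelThreshold A (i + j) (oplus a b) := by
  refine inf_eq_left.1 (Subtype.ext ?_)
  change meet (meet (threshold n i a) (threshold n j b)) (threshold n (i + j) (oplus a b)) =
    meet (threshold n i a) (threshold n j b)
  simpa only [Hom.map_meet', Hom.map_oplus', Hom.map_threshold, Term.evalHom_var, cond_true,
      cond_false] using
    A.evalHom_eq (s := meet (meet (threshold n i (.var true)) (threshold n j (.var false)))
        (threshold n (i + j) (oplus (.var true) (.var false))))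
      (t := meet (threshold n i (.var true)) (threshold n j (.var false))) (fun v => by
        simp only [Hom.map_meet', Hom.map_oplus', Hom.map_threshold, Term.evalHom_var, num_meet,
          num_oplus, num_threshold]
        split_ifs <;> omega) a b

theorem skelThreshold_oplus_le_sup (i j : ℕ) (a b : A) :
    skelThreshold A (i + j + 1) (oplus a b) ≤
      skelThreshold A (i + 1) a ⊔ skelThreshold A (j + 1) b := by
  refine sup_eq_right.1 (Subtype.ext ?_)
  change join (threshold n (i + j + 1) (oplus a b))
    (join (threshold n (i + 1) a) (threshold n (j + 1) b)) =
    join (threshold n (i + 1) a) (threshold n (j + 1) b)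
  simpa only [Hom.map_join', Hom.map_oplus', Hom.map_threshold, Term.evalHom_var, cond_true,
      cond_false] using
    A.evalHom_eq (s := join (threshold n (i + j + 1) (oplus (.var true) (.var false)))
        (join (threshold n (i + 1) (.var true)) (threshold n (j + 1) (.var false))))
      (t := join (threshold n (i + 1) (.var true)) (threshold n (j + 1) (.var false)))
      (fun v => by
        simp only [Hom.map_join', Hom.map_oplus', Hom.map_threshold, Term.evalHom_var, num_join,
          num_oplus, num_threshold]
        split_ifs <;> omega) a b

theorem inf_le_skelThreshold_odot (i j : ℕ) (a b : A) :
    skelThreshold A i a ⊓ skelThreshold A j b ≤ skelThreshold A (i + j - n) (odot a b) := by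
  refine inf_eq_left.1 (Subtype.ext ?_)
  change meet (meet (threshold n i a) (threshold n j b)) (threshold n (i + j - n) (odot a b)) =
    meet (threshold n i a) (threshold n j b)
  simpa only [Hom.map_meet', Hom.map_odot', Hom.map_threshold, Term.evalHom_var, cond_true,
      cond_false] using
    A.evalHom_eq (s := meet (meet (threshold n i (.var true)) (threshold n j (.var false)))
        (threshold n (i + j - n) (odot (.var true) (.var false))))
      (t := meet (threshold n i (.var true)) (threshold n j (.var false))) (fun v => by
        simp only [Hom.map_meet', Hom.map_odot', Hom.map_threshold, Term.evalHom_var, num_meet,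
          num_odot, num_threshold]
        split_ifs <;> omega) a b

theorem skelThreshold_odot_le_sup (i j : ℕ) (a b : A) :
    skelThreshold A (i + j - n + 1) (odot a b) ≤
      skelThreshold A (i + 1) a ⊔ skelThreshold A (j + 1) b := by
  refine sup_eq_right.1 (Subtype.ext ?_)
  change join (threshold n (i + j - n + 1) (odot a b))
    (join (threshold n (i + 1) a) (threshold n (j + 1) b)) =
    join (threshold n (i + 1) a) (threshold n (j + 1) b)
  simpa only [Hom.map_join', Hom.map_odot', Hom.map_threshold, Term.evalHom_var, cond_true,
      cond_false] using
    A.evalHom_eq (s := join (threshold n (i + j - n + 1) (odot (.var true) (.var false)))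
        (join (threshold n (i + 1) (.var true)) (threshold n (j + 1) (.var false))))
      (t := join (threshold n (i + 1) (.var true)) (threshold n (j + 1) (.var false)))
      (fun v => by
        simp only [Hom.map_join', Hom.map_odot', Hom.map_threshold, Term.evalHom_var, num_join,
          num_odot, num_threshold]
        split_ifs <;> omega) a b

theorem skelThreshold_antitone {i j : ℕ} (h : i ≤ j) (a : A) :
    skelThreshold A j a ≤ skelThreshold A i a := by
  refine inf_eq_left.1 (Subtype.ext ?_)
  change meet (threshold n j a) (threshold n i a) = threshold n j a
  simpa only [Hom.map_meet', Hom.map_threshold, Term.evalHom_var, cond_true] using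
    A.evalHom_eq (s := meet (threshold n j (.var true)) (threshold n i (.var true)))
      (t := threshold n j (.var true)) (fun v => by
        simp only [Hom.map_meet', Hom.map_threshold, Term.evalHom_var, num_meet, num_threshold]
        split_ifs <;> omega) a a

theorem skelThreshold_of_lt {k : ℕ} (h : n < k) (a : A) : skelThreshold A k a = ⊥ := by
  apply Subtype.ext
  change threshold n k a = zero
  rw [threshold, if_neg (by omega), if_pos h]

theorem skelThreshold_zero {k : ℕ} (hk : k ≠ 0) : skelThreshold A k zero = ⊥ := by
  apply Subtype.ext
  change threshold n k zero = (zero : A)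
  simpa only [Hom.map_zero', Hom.map_threshold] using
    A.evalHom_eq (s := threshold n k zero) (t := zero) (fun v => by
        simp only [Hom.map_zero', Hom.map_threshold, num_zero, num_threshold]
        split_ifs <;> omega) zero zero

theorem skelThreshold_one {k : ℕ} (hk : k ≤ n) : skelThreshold A k one = ⊤ := by
  apply Subtype.ext
  change threshold n k one = (one : A)
  simpa only [Hom.map_one', Hom.map_threshold] using
    A.evalHom_eq (s := threshold n k one) (t := one) (fun v => by
        simp only [Hom.map_one', Hom.map_threshold, num_one, num_threshold, if_pos hk]) one one

/-- The multiple `a ⊕ ⋯ ⊕ a` with `m + 1` summands. -/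
def multiple {A : Type*} [Sig A] : ℕ → A → A
  | 0, a => a
  | m + 1, a => oplus (multiple m a) a

theorem Hom.map_multiple {A B : Type*} [Sig A] [Sig B] (f : Hom A B) (m : ℕ) (a : A) :
    f.toFun (multiple m a) = multiple m (f.toFun a) := by
  induction m with
  | zero => rfl
  | succ m ih => rw [multiple, f.map_oplus', ih, multiple]

theorem num_multiple (m : ℕ) (x : chain n) : num (multiple m x) = min n ((m + 1) * num x) := by
  induction m with
  | zero => simpa [multiple] using num_le x
  | succ m ih =>
    rw [multiple, num_oplus, ih, add_mul (m + 1)]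
    omega

theorem multiple_skel (m : ℕ) (a : Skel A) : multiple m a.1 = a.1 := by
  induction m with
  | zero => rfl
  | succ m ih => rw [multiple, ih, a.2]

/-- Idempotence of `a` is an assumption, so the claim is not itself an identity to be transferred.
In the chain, however, the sum of `n + 1` copies of any element is `0` or `1`, hence fixed by `τ_k`;
this is an identity, and for idempotent `a` the sum is `a`. -/
theorem skelThreshold_skel {k : ℕ} (hk : k ≠ 0) (hkn : k ≤ n) (a : Skel A) :
    skelThreshold A k a.1 = a := by
  apply Subtype.ext
  change threshold n k a.1 = a.1
  have h : threshold n k (multiple n a.1) = multiple n a.1 := by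
    simpa only [Hom.map_multiple, Hom.map_threshold, Term.evalHom_var, cond_true] using
      A.evalHom_eq (s := threshold n k (multiple n (.var true)))
        (t := multiple n (.var true)) (fun v => by
          simp only [Hom.map_multiple, Hom.map_threshold, Term.evalHom_var, num_multiple,
            num_threshold]
          generalize num (v true) = p
          rcases Nat.eq_zero_or_pos p with rfl | hp
          · rw [if_neg (by omega), mul_zero, Nat.min_zero]
          · have : n + 1 ≤ (n + 1) * p := Nat.le_mul_of_pos_right _ hp
            rw [min_eq_left (by omega), if_pos hkn]) a.1 a.1
  rwa [multiple_skel] at h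

theorem skelMap_skelThreshold {A B : PMV.{u} n} (f : A ⟶ B) (k : ℕ) (a : A) :
    skelMap f (skelThreshold A k a) = skelThreshold B k (Hom.toFun f a) :=
  Subtype.ext (Hom.map_threshold f n k a)

end Identities

/-! ### The unit -/

section Unit

variable {n : ℕ} [NeZero n] {A : PMV.{u} n}

/-- The largest `k / n` such that `k` satisfies the given predicate. -/
noncomputable def greatest (b : Fin (n + 1) → Bool) : chain n :=
  ofNum (Nat.findGreatest (fun k => b (Fin.ofNat (n + 1) k)) n) (Nat.findGreatest_le n)

/-- The value of the unit on `a` at the point `x` of the dual of the skeleton. -/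
noncomputable def level (a : A) (x : Dual (Skel A)) : chain n :=
  greatest fun k => x (skelThreshold A k a)

theorem Dual.mono {L : Type*} [Lattice L] [BoundedOrder L] (x : Dual L) {a b : L} (h : a ≤ b)
    (ha : x a = true) : x b = true :=
  top_le_iff.1 (ha.symm.le.trans (OrderHomClass.mono (show BoundedLatticeHom L Bool from x) h))

theorem Dual.map_sup {L : Type*} [Lattice L] [BoundedOrder L] (x : Dual L) (a b : L) :
    x (a ⊔ b) = (x a || x b) :=
  (BoundedLatticeHom.toLatticeHom x).map_sup' a b

theorem Dual.map_inf {L : Type*} [Lattice L] [BoundedOrder L] (x : Dual L) (a b : L) :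
    x (a ⊓ b) = (x a && x b) :=
  (BoundedLatticeHom.toLatticeHom x).map_inf' a b

theorem Dual.map_top {L : Type*} [Lattice L] [BoundedOrder L] (x : Dual L) : x ⊤ = true :=
  BoundedLatticeHom.map_top' x

theorem Dual.map_bot {L : Type*} [Lattice L] [BoundedOrder L] (x : Dual L) : x ⊥ = false :=
  BoundedLatticeHom.map_bot' x

/-- The set of `k` with `x (τ_k a) = 1` contains `0`, is bounded by `n` and is downward closed since
thresholds decrease, so its maximum determines it. All properties of the unit are derived from this
equivalence. -/
theorem le_num_level (a : A) (x : Dual (Skel A)) (k : ℕ) :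
    k ≤ num (level a x) ↔ x (skelThreshold A k a) = true := by
  -- `Fin.ofNat` reduces modulo `n + 1`, which changes nothing in the range searched.
  have key : ∀ j ≤ n, (Fin.ofNat (n + 1) j : ℕ) = j := fun j hj =>
    Nat.mod_eq_of_lt (Nat.lt_succ_of_le hj)
  rw [level, greatest, num_ofNum]
  set p := Nat.findGreatest (fun j => x (skelThreshold A (Fin.ofNat (n + 1) j) a) = true) n
    with hp
  have hpn : p ≤ n := Nat.findGreatest_le n
  constructor
  · intro h
    have := Nat.findGreatest_spec (P := fun j => x (skelThreshold A (Fin.ofNat (n + 1) j) a) = true)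
      (Nat.zero_le n) (by
        rw [key 0 (Nat.zero_le n)]; exact x.map_top)
    rw [← hp] at this
    change x (skelThreshold A _ a) = true at this
    rw [key p hpn] at this
    exact x.mono (skelThreshold_antitone A h a) this
  · intro h
    have hk : k ≤ n := by
      by_contra hk
      rw [skelThreshold_of_lt A (by omega), x.map_bot] at h
      exact Bool.noConfusion h
    refine Nat.le_findGreatest hk ?_
    rwa [key k hk]

theorem eq_of_le_num {x y : chain n} (h : ∀ k, k ≤ num x ↔ k ≤ num y) : x = y :=
  num_injective (le_antisymm ((h _).1 le_rfl) ((h _).2 le_rfl))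

theorem skelThreshold_num_level (a : A) (x : Dual (Skel A)) :
    x (skelThreshold A (num (level a x)) a) = true := (le_num_level a x _).1 le_rfl

theorem skelThreshold_num_level_succ (a : A) (x : Dual (Skel A)) :
    x (skelThreshold A (num (level a x) + 1) a) = false := by
  have := (le_num_level a x (num (level a x) + 1)).not.1 (by omega)
  simpa using this

theorem num_level_eq {a : A} {x : Dual (Skel A)} {k : ℕ}
    (h₁ : x (skelThreshold A k a) = true) (h₂ : x (skelThreshold A (k + 1) a) = false) :
    num (level a x) = k := by
  have h₁ := (le_num_level a x k).2 h₁
  have h₂ := (le_num_level a x (k + 1)).not.2 (by simp [h₂])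
  omega

theorem level_meet (a b : A) (x : Dual (Skel A)) :
    level (meet a b) x = meet (level a x) (level b x) :=
  eq_of_le_num fun k => by
    rw [num_meet, le_min_iff, le_num_level, le_num_level, le_num_level, skelThreshold_meet,
      x.map_inf, Bool.and_eq_true]

theorem level_join (a b : A) (x : Dual (Skel A)) :
    level (join a b) x = join (level a x) (level b x) :=
  eq_of_le_num fun k => by
    rw [num_join, le_max_iff, le_num_level, le_num_level, le_num_level, skelThreshold_join,
      x.map_sup, Bool.or_eq_true]

theorem Dual.eq_false_of_le_sup {L : Type*} [Lattice L] [BoundedOrder L] (x : Dual L) {a b c : L}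
    (h : c ≤ a ⊔ b) (ha : x a = false) (hb : x b = false) : x c = false := by
  by_contra hc
  have := x.mono h (by simpa using hc)
  rw [x.map_sup, ha, hb] at this
  exact Bool.noConfusion this

/-- With `i` and `j` the levels of `a` and `b`, preservation of meets by `x` bounds the level of `a
⊙ b` from below. From above, `x` vanishes on both `τ_{i+1} a` and `τ_{j+1} b`, hence on their join.
-/
theorem level_odot (a b : A) (x : Dual (Skel A)) :
    level (odot a b) x = odot (level a x) (level b x) := by
  apply num_injective
  rw [num_odot]
  refine num_level_eq ?_ ?_
  · refine x.mono (inf_le_skelThreshold_odot A _ _ a b) ?_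
    rw [x.map_inf, skelThreshold_num_level, skelThreshold_num_level, Bool.and_self]
  · exact x.eq_false_of_le_sup (skelThreshold_odot_le_sup A _ _ a b)
      (skelThreshold_num_level_succ a x) (skelThreshold_num_level_succ b x)

theorem level_oplus (a b : A) (x : Dual (Skel A)) :
    level (oplus a b) x = oplus (level a x) (level b x) := by
  apply num_injective
  rw [num_oplus]
  have ha := num_le (level a x)
  rcases le_total (num (level a x) + num (level b x)) n with h | h
  · rw [min_eq_right h]
    refine num_level_eq ?_ ?_
    · refine x.mono (inf_le_skelThreshold_oplus A _ _ h a b) ?_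
      rw [x.map_inf, skelThreshold_num_level, skelThreshold_num_level, Bool.and_self]
    · exact x.eq_false_of_le_sup (skelThreshold_oplus_le_sup A _ _ a b)
        (skelThreshold_num_level_succ a x) (skelThreshold_num_level_succ b x)
  · rw [min_eq_left h]
    refine le_antisymm (num_le _) ((le_num_level _ _ _).2 ?_)
    -- In the saturated case the threshold used for `b` is lowered so that the two indices add up to
    -- exactly `n`, as the inequality for `⊕` requires.
    have e : num (level a x) + (n - num (level a x)) = n := by omega
    have := inf_le_skelThreshold_oplus A (num (level a x)) (n - num (level a x)) e.le a b
    rw [e] at this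
    refine x.mono this ?_
    rw [x.map_inf, skelThreshold_num_level, (le_num_level b x _).1 (by omega), Bool.and_self]

theorem level_zero (x : Dual (Skel A)) : level zero x = zero := by
  apply num_injective
  rw [num_zero]
  refine num_level_eq x.map_top ?_
  rw [skelThreshold_zero A (by omega), x.map_bot]

theorem level_one (x : Dual (Skel A)) : level one x = one := by
  apply num_injective
  rw [num_one]
  refine le_antisymm (num_le _) ((le_num_level _ _ _).2 ?_)
  rw [skelThreshold_one A le_rfl, x.map_top]

theorem level_monotone (a : A) : Monotone (level a) := fun x y h =>
  num_le_num.1 ((le_num_level a y _).2 (top_le_iff.1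
    ((skelThreshold_num_level a x).symm.le.trans (h _))))

theorem Dual.continuous_eval {L : Type*} [Lattice L] [BoundedOrder L] (a : L) :
    Continuous fun x : Dual L => x a :=
  (continuous_apply a).comp continuous_induced_dom

/-- The level depends only on the finitely many values `x (τ_k a)` with `k ≤ n`. It factors through
the finite discrete space `Fin (n + 1) → Bool`, which is why `greatest` takes its argument there. -/
theorem level_continuous (a : A) : Continuous (level a) :=
  (continuous_of_discreteTopology (f := greatest (n := n))).comp
    (continuous_pi fun _ => Dual.continuous_eval _)

variable (A)

/-- The unit of the adjunction. -/
noncomputable def unitHom : Hom A (PriestleyPower (chain n) (Skel A)) where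
  toFun a := ⟨⟨level a, level_monotone a⟩, level_continuous a⟩
  map_meet' a b := ContinuousOrderHom.ext (level_meet a b)
  map_join' a b := ContinuousOrderHom.ext (level_join a b)
  map_odot' a b := ContinuousOrderHom.ext (level_odot a b)
  map_oplus' a b := ContinuousOrderHom.ext (level_oplus a b)
  map_zero' := ContinuousOrderHom.ext level_zero
  map_one' := ContinuousOrderHom.ext level_one

variable {A}

theorem level_map {B : PMV.{u} n} (f : A ⟶ B) (a : A) (x : Dual (Skel B)) :
    level (Hom.toFun f a) x = level a (dualMap (skelMap f) x) :=
  eq_of_le_num fun k => by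
    rw [le_num_level, le_num_level, ← skelMap_skelThreshold]
    rfl

/-- Level `1` means `x (τ_n a) = 1`, and `τ_n a = a` on the skeleton. This is the left triangle
identity, tested at a point. -/
theorem level_skel_eq_one (a : Skel A) (x : Dual (Skel A)) :
    level a.1 x = one ↔ x a = true := by
  have hn : n ≠ 0 := NeZero.ne n
  rw [← num_injective.eq_iff, num_one, ← skelThreshold_skel A hn le_rfl a, ← le_num_level]
  rw [skelThreshold_skel A hn le_rfl a]
  exact ⟨fun h => h.ge, fun h => le_antisymm (num_le _) h⟩

end Unit

/-! ### Priestley duality -/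

section Priestley

variable {L : Type*} [DistribLattice L] [BoundedOrder L]

/-- The prime ideal theorem separates the filter generated by `a` from the ideal generated by `b`;
the point is the characteristic function of the complement of the prime ideal. -/
theorem exists_dual_of_not_le {a b : L} (h : ¬ a ≤ b) :
    ∃ x : Dual L, x a = true ∧ x b = false := by
  classical
  obtain ⟨J, hJ, hbJ, haJ⟩ := DistribLattice.prime_ideal_of_disjoint_filter_ideal
    (F := Order.PFilter.principal a) (I := Order.Ideal.principal b) (by
      rw [Set.disjoint_left]
      intro c hc hc'
      exact h (le_trans (Order.PFilter.mem_principal.1 hc) (Order.Ideal.mem_principal.1 hc')))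
  have htop : ⊤ ∉ J := fun ht => hJ.toIsProper.ne_univ
    (Set.eq_univ_of_forall fun c => J.lower le_top ht)
  have hinf : ∀ c d, c ⊓ d ∈ J ↔ c ∈ J ∨ d ∈ J := fun c d =>
    ⟨hJ.mem_or_mem, fun h => h.elim (J.lower inf_le_left) (J.lower inf_le_right)⟩
  let x : BoundedLatticeHom L Bool :=
    { toFun := fun c => decide (c ∉ J)
      map_sup' := fun c d => by
        simp only [Order.Ideal.sup_mem_iff, Bool.sup_eq_bor, not_and_or, Bool.decide_or]
      map_inf' := fun c d => by
        simp only [hinf, Bool.inf_eq_band, not_or, Bool.decide_and]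
      map_top' := by simpa using htop
      map_bot' := by simp }
  refine ⟨x, ?_, ?_⟩
  · have : a ∉ J := fun ha => Set.disjoint_left.1 haJ (Order.PFilter.mem_principal.2 le_rfl) ha
    exact decide_eq_true this
  · have : b ∈ J := hbJ (Order.Ideal.mem_principal.2 le_rfl)
    exact decide_eq_false (not_not.2 this)

/-- Points separate elements, so equations in a lattice can be tested at the points of its dual. The
counit is known only through its values there. -/
theorem Dual.eq_of_forall {a b : L} (h : ∀ x : Dual L, x a = true ↔ x b = true) : a = b := by
  by_contra hab
  rcases not_and_or.1 (mt (fun h => le_antisymm h.1 h.2) hab) with hab | hab <;>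
    obtain ⟨x, h₁, h₂⟩ := exists_dual_of_not_le hab <;> have := h x <;> simp_all

/-- The homomorphism conditions each involve finitely many coordinates, so they cut out a closed
subset of the compact space of all maps from `L` to `Bool`. -/
instance : CompactSpace (Dual L) := by
  have hind : Topology.IsInducing (fun (x : Dual L) (a : L) => x a) := ⟨rfl⟩
  rw [← isCompact_univ_iff, hind.isCompact_iff, Set.image_univ]
  apply IsClosed.isCompact
  have : Set.range (fun (x : Dual L) (a : L) => x a) =
      {f : L → Bool | (∀ a b, f (a ⊔ b) = (f a || f b)) ∧ (∀ a b, f (a ⊓ b) = (f a && f b)) ∧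
        f ⊤ = true ∧ f ⊥ = false} := by
    ext f
    constructor
    · rintro ⟨x, rfl⟩
      exact ⟨x.map_sup, x.map_inf, x.map_top, x.map_bot⟩
    · rintro ⟨h₁, h₂, h₃, h₄⟩
      exact ⟨(⟨⟨⟨f, h₁⟩, h₂⟩, h₃, h₄⟩ : BoundedLatticeHom L Bool), rfl⟩
  rw [this]
  have hc₂ : ∀ (g : Bool → Bool → Bool) (a b : L), Continuous fun f : L → Bool => g (f a) (f b) :=
    fun g a b => (continuous_of_discreteTopology (f := fun p : Bool × Bool => g p.1 p.2)).comp
      (Continuous.prodMk (continuous_apply a) (continuous_apply b))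
  simp only [Set.ofPred_and, Set.ofPred_forall]
  refine IsClosed.inter ?_ (IsClosed.inter ?_ (IsClosed.inter ?_ ?_))
  · exact isClosed_iInter fun a => isClosed_iInter fun b =>
      isClosed_eq (continuous_apply _) (hc₂ or a b)
  · exact isClosed_iInter fun a => isClosed_iInter fun b =>
      isClosed_eq (continuous_apply _) (hc₂ and a b)
  · exact isClosed_eq (continuous_apply _) continuous_const
  · exact isClosed_eq (continuous_apply _) continuous_const

theorem Dual.isOpen_eval_eq (a : L) (i : Bool) : IsOpen {x : Dual L | x a = i} :=
  (isOpen_discrete {i}).preimage (Dual.continuous_eval a)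

/-- Clopen up-sets of the Priestley dual are represented by elements of the lattice. -/
theorem exists_mem_iff_of_isClopen {U : Set (Dual L)} (hU : IsClopen U) (hup : IsUpperSet U) :
    ∃ a : L, ∀ x : Dual L, x a = true ↔ x ∈ U := by
  -- For fixed `y` outside `U`, each `x ∈ U` satisfies `¬ x ≤ y`, since `U` is an up-set, so some
  -- `a` has `x a = 1` and `y a = 0`. Compactness of `U` allows a finite join of such elements to
  -- serve all of `U`.
  have sep : ∀ y ∉ U, ∃ a : L, (∀ x ∈ U, x a = true) ∧ y a = false := by
    intro y hy
    refine hU.isClosed.isCompact.induction_on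
      (p := fun S => ∃ a : L, (∀ x ∈ S, x a = true) ∧ y a = false) ?_ ?_ ?_ ?_
    · exact ⟨⊥, fun _ h => h.elim, y.map_bot⟩
    · rintro S T hST ⟨a, ha, hya⟩
      exact ⟨a, fun x hx => ha x (hST hx), hya⟩
    · rintro S T ⟨a, ha, hya⟩ ⟨b, hb, hyb⟩
      refine ⟨a ⊔ b, ?_, by rw [y.map_sup, hya, hyb, Bool.or_self]⟩
      rintro x (hx | hx)
      · rw [x.map_sup, ha x hx, Bool.true_or]
      · rw [x.map_sup, hb x hx, Bool.or_true]
    · intro x hx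
      have hxy : ¬ x ≤ y := fun h => hy (hup h hx)
      obtain ⟨a, ha⟩ : ∃ a, ¬ x a ≤ y a := not_forall.1 hxy
      have hxa : x a = true ∧ y a = false := by
        revert ha
        cases x a <;> cases y a <;> decide
      exact ⟨_, mem_nhdsWithin_of_mem_nhds ((Dual.isOpen_eval_eq a true).mem_nhds hxa.1), a,
        fun _ h => h, hxa.2⟩
  -- Dually, compactness of the complement allows a finite meet of the elements from `sep` to vanish
  -- on all points outside `U`.
  obtain ⟨a, ha, ha'⟩ := hU.compl.isClosed.isCompact.induction_on
      (p := fun S => ∃ a : L, (∀ x ∈ U, x a = true) ∧ ∀ y ∈ S, y a = false)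
      ⟨⊤, fun x _ => x.map_top, fun _ h => h.elim⟩
      (fun S T hST ⟨a, ha, h⟩ => ⟨a, ha, fun y hy => h y (hST hy)⟩)
      (fun S T ⟨a, ha, h⟩ ⟨b, hb, h'⟩ => by
        refine ⟨a ⊓ b, fun x hx => by rw [x.map_inf, ha x hx, hb x hx, Bool.and_self], ?_⟩
        rintro y (hy | hy)
        · rw [y.map_inf, h y hy, Bool.false_and]
        · rw [y.map_inf, h' y hy, Bool.and_false])
      (fun y hy => by
        obtain ⟨a, ha, hya⟩ := sep y hy
        exact ⟨_, mem_nhdsWithin_of_mem_nhds ((Dual.isOpen_eval_eq a false).mem_nhds hya), a, ha,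
          fun _ h => h⟩)
  refine ⟨a, fun x => ⟨fun hx => ?_, ha x⟩⟩
  by_contra hxU
  rw [ha' x hxU] at hx
  exact Bool.noConfusion hx

end Priestley

/-! ### The counit -/

section Counit

variable {n : ℕ} [NeZero n] {L : BddDistLat.{u}}

/-- The set where the function equals `1` is clopen because the chain is discrete, and an up-set
because `1` is the greatest element. -/
theorem exists_counit (φ : Skel ((priestleyPowerFunctor n).obj L)) :
    ∃ a : L, ∀ x : Dual L, x a = true ↔ (show PriestleyPower (chain n) L from φ.1) x = one := by
  let α : PriestleyPower (chain n) L := φ.1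
  refine exists_mem_iff_of_isClopen (U := {x | α x = one})
    ((isClopen_discrete {(one : chain n)}).preimage α.continuous_toFun) ?_
  intro x y hxy hx
  have h : α x ≤ α y := α.monotone' hxy
  rw [Set.mem_ofPred_eq] at hx
  rw [hx, ← num_le_num, num_one] at h
  exact num_injective ((le_antisymm (num_le _) h).trans num_one.symm)

/-- The element of `L` represented by an element of the skeleton of the Priestley power. -/
noncomputable def counitFun (φ : Skel ((priestleyPowerFunctor n).obj L)) : L :=
  (exists_counit φ).choose

theorem dual_counitFun (φ : Skel ((priestleyPowerFunctor n).obj L)) (x : Dual L) :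
    x (counitFun φ) = true ↔ (show PriestleyPower (chain n) L from φ.1) x = one :=
  (exists_counit φ).choose_spec x

theorem meet_eq_one (x y : chain n) : meet x y = one ↔ x = one ∧ y = one := by
  have hx := num_le x
  have hy := num_le y
  rw [← num_injective.eq_iff, ← num_injective.eq_iff, ← num_injective.eq_iff, num_meet, num_one]
  omega

/-- In a chain a join is one of its two arguments; this is what makes the counit preserve joins. -/
theorem join_eq_one (x y : chain n) : join x y = one ↔ x = one ∨ y = one := by
  have hx := num_le x
  have hy := num_le y
  rw [← num_injective.eq_iff, ← num_injective.eq_iff, ← num_injective.eq_iff, num_join, num_one]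
  omega

theorem zero_ne_one : (zero : chain n) ≠ one := by
  rw [← num_injective.ne_iff, num_zero, num_one]
  exact (NeZero.ne n).symm

variable (n L) in
/-- The counit of the adjunction. -/
noncomputable def counitHom : BoundedLatticeHom (Skel ((priestleyPowerFunctor n).obj L)) L where
  toFun := counitFun
  map_sup' φ ψ := Dual.eq_of_forall fun x => by
    rw [x.map_sup, Bool.or_eq_true, dual_counitFun, dual_counitFun, dual_counitFun]
    exact join_eq_one _ _
  map_inf' φ ψ := Dual.eq_of_forall fun x => by
    rw [x.map_inf, Bool.and_eq_true, dual_counitFun, dual_counitFun, dual_counitFun]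
    exact meet_eq_one _ _
  map_top' := Dual.eq_of_forall fun x => by
    rw [x.map_top, dual_counitFun]
    exact iff_of_true rfl rfl
  map_bot' := Dual.eq_of_forall fun x => by
    rw [dual_counitFun, x.map_bot]
    exact iff_of_false zero_ne_one Bool.false_ne_true

/-- Evaluation of the Priestley power at a point. -/
noncomputable def powerEval (n : ℕ) [NeZero n] {L : Type u} [Lattice L] [BoundedOrder L] (x : Dual L) :
    Hom (PriestleyPower (chain n) L) (chain n) where
  toFun α := α x
  map_meet' _ _ := rfl
  map_join' _ _ := rfl
  map_odot' _ _ := rfl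
  map_oplus' _ _ := rfl
  map_zero' := rfl
  map_one' := rfl

/-- This is the right triangle identity at a point. Evaluation at `x` is a homomorphism, so `τ_k α`
has value `τ_k (α x)` at `x`, which is `1` exactly when `k` is at most the numerator of `α x`. -/
theorem level_dualMap_counitHom (α : (priestleyPowerFunctor n).obj L) (x : Dual L) :
    level α (dualMap (counitHom n L) x) = (show PriestleyPower (chain n) L from α) x :=
  eq_of_le_num fun k => by
    have hn : n ≠ 0 := NeZero.ne n
    rw [le_num_level]
    change x (counitFun (skelThreshold _ k α)) = true ↔ _
    rw [dual_counitFun]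
    have e := (powerEval n x).map_threshold n k α
    refine (Eq.congr_left e).trans ?_
    rw [← num_injective.eq_iff, num_threshold, num_one]
    change _ ↔ k ≤ num ((powerEval n x).toFun α)
    split_ifs with h <;> simp [h, hn.symm]

end Counit

/-- The adjunction between the distributive skeleton and the Priestley power. -/
noncomputable def skeletonAdjunction (n : ℕ) [NeZero n] :
    skeletonFunctor.{u} n ⊣ priestleyPowerFunctor.{u} n :=
  Adjunction.mkOfUnitCounit
    { unit :=
        { app := fun A => unitHom A
          naturality := fun _ _ f => Hom.ext (funext fun a =>
            ContinuousOrderHom.ext fun x => level_map f a x) }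
      counit :=
        { app := fun L => BddDistLat.ofHom (counitHom n L)
          naturality := fun L L' h => by
            ext φ
            refine Dual.eq_of_forall fun (x : Dual L') => ?_
            -- At `x`, both sides say that `φ` takes the value `1` at `x ∘ h`.
            refine (dual_counitFun _ x).trans ?_
            exact (dual_counitFun φ (dualMap h.hom x)).symm }
      left_triangle := by
        ext A a
        refine Dual.eq_of_forall fun (x : Dual (Skel A)) => ?_
        refine (dual_counitFun (L := BddDistLat.of (Skel A)) _ x).trans ?_
        exact level_skel_eq_one a x
      right_triangle := by
        ext L
        refine Hom.ext (funext fun α => ContinuousOrderHom.ext fun x => ?_)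
        exact level_dualMap_counitHom α x }

end PosMV

theorem theorem4p6 (n : ℕ) [NeZero n] :
    Nonempty (PosMV.skeletonFunctor.{u} n ⊣ PosMV.priestleyPowerFunctor.{u} n) :=
  ⟨PosMV.skeletonAdjunction n⟩
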